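/- A mixed graph $G=(V,E\cup A)$ consists of a finite set $V$ of vertices, a finite set $E$ of undirected edges and a finite set $A$ of directed arcs; parallel edges and arcs are allowed, loops are not. Each arc has one head, and both endpoints of an edge are regarded as heads of it. A mixed covering forest in $G$ is a subset $F\subseteq E\cup A$ such that (i) the underlying undirected (multi)graph of $F$ has no cycle (two parallel elements form a cycle), and (ii) every vertex $v\in V$ is a head of at least one element of $F$. Let $G=(V,E\cup A)$ be a mixed graph that contains $k$ pairwise disjoint (that is, sharing no edge or arc) mixed covering forests. Then $G$ contains $k$ pairwise disjoint mixed covering forests $F_1,\dots,F_k$ such that, for all $i,j\in\{1,\dots,k\}$, $$\bigl||F_i|-|F_j|\bigr|\le 2,\qquad \bigl||F_i\cap E|-|F_j\cap E|\bigr|\le 1,\qquad \bigl||F_i\cap A|-|F_j\cap A|\bigr|\le 2.$$ -/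

import Mathlib

/-- A mixed graph with vertex set `V`, undirected edges indexed by `E` and arcs indexed by `A`.
Parallel edges and arcs are allowed, loops are not. -/
structure MixedGraph (V E A : Type*) where
  /-- the two endpoints of an edge -/
  ends : E → Sym2 V
  /-- the tail of an arc -/
  tail : A → V
  /-- the head of an arc -/
  head : A → V
  ends_not_isDiag : ∀ e, ¬ (ends e).IsDiag
  tail_ne_head : ∀ a, tail a ≠ head a

namespace MixedGraph

variable {V E A : Type*}

/-- The pair of endpoints of an edge or arc in the underlying undirected graph. -/
def underlyingEnds (G : MixedGraph V E A) : E ⊕ A → Sym2 V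
  | .inl e => G.ends e
  | .inr a => s(G.tail a, G.head a)

/-- `v` is a head of the edge or arc: both endpoints of an edge are heads of it, while an arc has
just one head. -/
def IsHead (G : MixedGraph V E A) : E ⊕ A → V → Prop
  | .inl e, v => v ∈ G.ends e
  | .inr a, v => v = G.head a

/-- The vertex `v` is covered in `F`, i.e. it is a head of a member of `F`. -/
def IsCovered (G : MixedGraph V E A) (F : Finset (E ⊕ A)) (v : V) : Prop :=
  ∃ x ∈ F, G.IsHead x v

/-- The underlying undirected multigraph of `F` contains a cycle: for some length `n + 2 ≥ 2`, there
are distinct vertices `v 0, …, v (n + 1)` and distinct members `x 0, …, x (n + 1)` of `F` such that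
`x i` joins `v i` to `v (i + 1)`, with indices taken modulo `n + 2`. Two parallel members
form a cycle of length 2. -/
def HasCycle (G : MixedGraph V E A) (F : Finset (E ⊕ A)) : Prop :=
  ∃ (n : ℕ) (v : Fin (n + 2) → V) (x : Fin (n + 2) → E ⊕ A),
    Function.Injective v ∧ Function.Injective x ∧
      ∀ i, x i ∈ F ∧ G.underlyingEnds (x i) = s(v i, v (i + 1))

/-- A mixed covering forest: the underlying undirected graph has no cycle, and every vertex is
covered at least once. -/
structure IsMixedCoveringForest (G : MixedGraph V E A) (F : Finset (E ⊕ A)) : Prop where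
  acyclic : ¬ G.HasCycle F
  covers : ∀ v, G.IsCovered F v

end MixedGraph

/-! The heart is the case of two forests; a potential argument extends it to k. Give each forest its
edge set `M b` and pool the arcs of both into `D`. A set of vertices that misses all edges of a
covering forest must be entered by one of its arcs, since otherwise going backwards along arcs gives
a cycle. Hence `D` meets Edmonds' condition for two disjoint branchings rooted at the vertex sets of
`M true` and `M false`. Any other bipartition of the edges that keeps this condition again yields
two coverings, and they are forests once no edge is redundant for its vertex set.

The condition survives recolouring as soon as both colours touch every minimal nonempty set that no
arc of `D` enters (`Packable.of_sources`). A branching with root set R has |V| - |R| arcs, so it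
remains to balance the numbers of edges and of touched vertices. Take a valid colouring with the
most vertices touched by both colours. At each such vertex, and in each minimal set without one,
pair two half-edges of opposite colours. The pairing joins edges into components with at most two
unpaired half-edges each, and each component may be flipped freely. The effect of a component on the
two differences is a vector with entries in {-1, 0, 1}, and `exists_signs` picks the flips. -/

/-! ### Small signed sums of plane vectors -/

/-- The sign `1` or `-1` of a colour. -/
def boolSign (b : Bool) : ℤ := if b then 1 else -1

theorem boolSign_not (b : Bool) : boolSign (!b) = -boolSign b := by cases b <;> rfl

theorem boolSign_beq (a b : Bool) : boolSign (a == b) = boolSign b * boolSign a := by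
  cases a <;> cases b <;> rfl

theorem abs_boolSign (b : Bool) : |boolSign b| = 1 := by cases b <;> rfl

/-- `(X, Z)` is a signed sum of the vectors `(x q, z q)` over `q ∈ T`. -/
def IsSignedSum {Q : Type*} (x z : Q → ℤ) (T : Finset Q) (X Z : ℤ) : Prop :=
  ∃ s : Q → Bool, ∑ q ∈ T, boolSign (s q) * x q = X ∧ ∑ q ∈ T, boolSign (s q) * z q = Z

namespace IsSignedSum

variable {Q : Type*} {x z : Q → ℤ}

theorem union [DecidableEq Q] {S T : Finset Q} {X Z X' Z' : ℤ} (hd : Disjoint S T)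
    (hS : IsSignedSum x z S X Z) (hT : IsSignedSum x z T X' Z') :
    IsSignedSum x z (S ∪ T) (X + X') (Z + Z') := by
  obtain ⟨s, rfl, rfl⟩ := hS
  obtain ⟨t, rfl, rfl⟩ := hT
  have hT' : ∀ q ∈ T, q ∉ S := fun q hq hq' => Finset.disjoint_left.1 hd hq' hq
  refine ⟨fun q => if q ∈ S then s q else t q, ?_, ?_⟩ <;>
  · rw [Finset.sum_union hd]
    congr 1
    · exact Finset.sum_congr rfl fun q hq => by simp [hq]
    · exact Finset.sum_congr rfl fun q hq => by simp [hT' q hq]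

theorem neg {T : Finset Q} {X Z : ℤ} (h : IsSignedSum x z T X Z) :
    IsSignedSum x z T (-X) (-Z) := by
  obtain ⟨s, rfl, rfl⟩ := h
  exact ⟨fun q => !s q, by simp [boolSign_not], by simp [boolSign_not]⟩

/-- Vectors that agree up to sign cancel, except possibly for one of them. -/
theorem of_parallel (T : Finset Q) (a b : ℤ)
    (h : ∀ q ∈ T, (x q = a ∧ z q = b) ∨ (x q = -a ∧ z q = -b)) :
    IsSignedSum x z T 0 0 ∨ IsSignedSum x z T a b := by
  classical
  induction T using Finset.induction_on with
  | empty => exact .inl ⟨fun _ => true, by simp, by simp⟩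
  | insert q T hq ih =>
    have single : IsSignedSum x z {q} a b := by
      rcases h q (by simp) with h | h
      · exact ⟨fun _ => true, by simp [boolSign, h], by simp [boolSign, h]⟩
      · exact ⟨fun _ => false, by simp [boolSign, h], by simp [boolSign, h]⟩
    rw [Finset.insert_eq]
    have hd : Disjoint {q} T := by simpa using hq
    rcases ih fun r hr => h r (by simp [hr]) with h | h
    · exact .inr (by simpa using single.union hd h)
    · exact .inl (by simpa using single.neg.union hd h)

end IsSignedSum

/-- Signs can be given to vectors in `{-1, 0, 1}²` so that the sum of the vectors is small. -/
theorem exists_signs {Q : Type*} [Fintype Q] (x z : Q → ℤ) (hx : ∀ q, |x q| ≤ 1)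
    (hz : ∀ q, |z q| ≤ 1) :
    ∃ X Z : ℤ, IsSignedSum x z Finset.univ X Z ∧ |X| ≤ 1 ∧ |Z| ≤ 2 ∧ |X + Z| ≤ 2 := by
  classical
  let T (a b : ℤ) : Finset Q := {q | (x q = a ∧ z q = b) ∨ (x q = -a ∧ z q = -b)}
  have hT (a b : ℤ) := IsSignedSum.of_parallel (x := x) (z := z) (T a b) a b (by simp [T])
  have hd {a b c d : ℤ} (h : ¬ ((a = c ∧ b = d) ∨ (a = -c ∧ b = -d))) :
      Disjoint (T a b) (T c d) := by
    rw [Finset.disjoint_left]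
    intro q
    simp only [T, Finset.mem_filter, Finset.mem_univ, true_and]
    intro h₁ h₂
    omega
  have huniv : ((T 1 1 ∪ T 1 (-1)) ∪ (T 1 0 ∪ T 0 1)) ∪ T 0 0 = Finset.univ := by
    ext q
    have h₁ := abs_le.1 (hx q)
    have h₂ := abs_le.1 (hz q)
    simp only [T, Finset.mem_union, Finset.mem_filter, Finset.mem_univ, true_and, iff_true]
    omega
  have h0 : IsSignedSum x z (T 0 0) 0 0 := (hT 0 0).elim id id
  have key {a b c d a' b' c' d' : ℤ} (h₁ : IsSignedSum x z (T 1 1) a a')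
      (h₂ : IsSignedSum x z (T 1 (-1)) b b') (h₃ : IsSignedSum x z (T 1 0) c c')
      (h₄ : IsSignedSum x z (T 0 1) d d') :
      IsSignedSum x z Finset.univ (a + b + (c + d) + 0) (a' + b' + (c' + d') + 0) := by
    rw [← huniv]
    refine ((h₁.union (hd (by omega)) h₂).union ?_ (h₃.union (hd (by omega)) h₄)).union ?_ h0 <;>
    simp only [Finset.disjoint_union_left, Finset.disjoint_union_right] <;>
    refine ⟨⟨hd ?_, hd ?_⟩, ⟨hd ?_, hd ?_⟩⟩ <;> omega
  -- Up to sign, at most one vector remains from each of the four nonzero classes; some choice of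
  -- signs for these meets all three bounds.
  rcases hT 1 1 with h₁ | h₁ <;> rcases hT 1 (-1) with h₂ | h₂ <;>
  rcases hT 1 0 with h₃ | h₃ <;> rcases hT 0 1 with h₄ | h₄ <;>
  first
  | exact ⟨_, _, key h₁ h₂ h₃ h₄, by decide, by decide, by decide⟩
  | exact ⟨_, _, key h₁ h₂.neg h₃ h₄, by decide, by decide, by decide⟩
  | exact ⟨_, _, key h₁ h₂ h₃.neg h₄, by decide, by decide, by decide⟩
  | exact ⟨_, _, key h₁ h₂ h₃ h₄.neg, by decide, by decide, by decide⟩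
  | exact ⟨_, _, key h₁ h₂.neg h₃ h₄.neg, by decide, by decide, by decide⟩

/-! ### Components formed by paired half-edges -/

/-- If half-edges of a graph are paired up, its edges can be labelled so that paired half-edges get
the same label and every label is seen by at most two unpaired half-edges. -/
theorem exists_labelling {N I : Type*} [Fintype N] (g : I → Bool → N × Bool)
    (hg : ∀ i j b c, g i b = g j c → i = j ∧ b = c) (S : Finset I) :
    ∃ π : N → N, (∀ i ∈ S, π (g i true).1 = π (g i false).1) ∧
      ∀ q, {h : N × Bool | (∀ i ∈ S, ∀ b, g i b ≠ h) ∧ π h.1 = q}.ncard ≤ 2 := by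
  classical
  induction S using Finset.induction_on with
  | empty =>
    refine ⟨id, by simp, fun q => ?_⟩
    have : {h : N × Bool | (∀ i ∈ (∅ : Finset I), ∀ b, g i b ≠ h) ∧ id h.1 = q}
        ⊆ {(q, true), (q, false)} := by
      rintro ⟨e, b⟩ ⟨-, h⟩
      cases b <;> simp_all
    exact (Set.ncard_le_ncard this).trans ((Set.ncard_insert_le _ _).trans (by simp))
  | insert i S hi ih =>
    obtain ⟨π, h₁, h₂⟩ := ih
    set a := π (g i true).1 with ha
    set c := π (g i false).1 with hc
    have hfree (b : Bool) : ∀ j ∈ S, ∀ b', g j b' ≠ g i b := fun j hj b' h =>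
      hi ((hg _ _ _ _ h).1 ▸ hj)
    refine ⟨fun e => if π e = c then a else π e, ?_, fun q => ?_⟩
    · intro j hj
      rcases Finset.mem_insert.1 hj with rfl | hj
      · simp [← ha, ← hc]
      · simp [h₁ j hj]
    · let Fr (q : N) : Set (N × Bool) := {h | (∀ i ∈ S, ∀ b, g i b ≠ h) ∧ π h.1 = q}
      change ∀ q, (Fr q).ncard ≤ 2 at h₂
      change Set.ncard {h : N × Bool | (∀ j ∈ insert i S, ∀ b, g j b ≠ h) ∧
            (if π h.1 = c then a else π h.1) = q} ≤ 2
      -- Merging label `c` into `a` leaves at most (2 - 1) + (2 - 1) unpaired half-edges, as each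
      -- class loses the half-edge that is now paired.
      by_cases hq : q = a
      · have hsub : {h : N × Bool | (∀ j ∈ insert i S, ∀ b, g j b ≠ h) ∧
            (if π h.1 = c then a else π h.1) = q} ⊆ (Fr a \ {g i true}) ∪ (Fr c \ {g i false}) := by
          rintro h ⟨h₃, h₄⟩
          have h₅ : ∀ j ∈ S, ∀ b, g j b ≠ h := fun j hj => h₃ j (by simp [hj])
          have h₆ := fun b => (h₃ i (by simp) b).symm
          by_cases h₇ : π h.1 = c
          · exact .inr ⟨⟨h₅, h₇⟩, h₆ false⟩
          · rw [if_neg h₇] at h₄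
            exact .inl ⟨⟨h₅, h₄.trans hq⟩, h₆ true⟩
        have c₁ := Set.ncard_sdiff_singleton_lt_of_mem
          (show g i true ∈ Fr a from ⟨hfree true, rfl⟩)
        have c₂ := Set.ncard_sdiff_singleton_lt_of_mem
          (show g i false ∈ Fr c from ⟨hfree false, rfl⟩)
        have := (Set.ncard_le_ncard hsub).trans (Set.ncard_union_le _ _)
        have := h₂ a
        have := h₂ c
        omega
      · refine (Set.ncard_le_ncard ?_).trans (h₂ q)
        rintro h ⟨h₃, h₄⟩
        refine ⟨fun j hj => h₃ j (by simp [hj]), ?_⟩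
        split_ifs at h₄ with h₅
        · exact absurd h₄.symm hq
        · exact h₄

/-! ### Balanced recolouring of the edges -/

section Coloring

variable {N V : Type*}

/-- The vertex `v` is an endpoint of an edge of colour `b`; here `p` gives the two endpoints of each
edge. -/
def IsTouched (p : N × Bool → V) (χ : N → Bool) (b : Bool) (v : V) : Prop :=
  ∃ h, p h = v ∧ χ h.1 = b

/-- Every member of `𝒦` has endpoints of edges of both colours. -/
def TouchesAll (p : N × Bool → V) (𝒦 : Set (Set V)) (χ : N → Bool) : Prop :=
  ∀ K ∈ 𝒦, ∀ b, ∃ v ∈ K, IsTouched p χ b v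

open Classical in
/-- The difference of the numbers of vertices touched by the two colours. -/
noncomputable def touchDiff [Fintype V] (p : N × Bool → V) (χ : N → Bool) : ℤ :=
  ∑ v, ((if IsTouched p χ true v then 1 else 0) - (if IsTouched p χ false v then 1 else 0))

/-- A sum that cancels on the paired half-edges is at most `2` in absolute value. -/
theorem abs_sum_le_two_of_paired [Fintype N] [DecidableEq N] {I : Type*} [Fintype I]
    (g : I → Bool → N × Bool) (hg : ∀ i j b c, g i b = g j c → i = j ∧ b = c) (π : N → N)
    (hπ : ∀ i, π (g i true).1 = π (g i false).1) (q : N)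
    (hq : {h : N × Bool | (∀ i b, g i b ≠ h) ∧ π h.1 = q}.ncard ≤ 2) (f : N × Bool → ℤ)
    (hf : ∀ i, f (g i true) = -f (g i false)) (hf₁ : ∀ h, |f h| ≤ 1) :
    |∑ h with π h.1 = q, f h| ≤ 2 := by
  classical
  have hsplit := Finset.sum_filter_add_sum_filter_not ({h | π h.1 = q} : Finset (N × Bool))
    (fun h => ∃ i b, g i b = h) f
  have h₁ : ∑ h ∈ ({h | π h.1 = q} : Finset (N × Bool)) with (∃ i b, g i b = h), f h = 0 := by
    have himg : Finset.filter (fun h => ∃ i b, g i b = h) ({h | π h.1 = q} : Finset (N × Bool)) =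
        Finset.image (fun ib : I × Bool => g ib.1 ib.2)
          (({i | π (g i true).1 = q} : Finset I) ×ˢ Finset.univ) := by
      ext h
      simp only [Finset.mem_filter, Finset.mem_univ, true_and, Finset.mem_image,
        Finset.mem_product, and_true, Prod.exists]
      constructor
      · rintro ⟨h₁, i, b, rfl⟩
        refine ⟨i, b, ?_, rfl⟩
        cases b
        · rw [hπ, h₁]
        · exact h₁
      · rintro ⟨i, b, h₁, rfl⟩
        refine ⟨?_, i, b, rfl⟩
        cases b
        · rw [← hπ, h₁]
        · exact h₁
    rw [himg, Finset.sum_image, Finset.sum_product]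
    · exact Finset.sum_eq_zero fun i _ => by simp [hf]
    · rintro ⟨i, b⟩ - ⟨j, c⟩ - h
      obtain ⟨rfl, rfl⟩ := hg _ _ _ _ h
      rfl
  rw [← hsplit, h₁, zero_add]
  refine (Finset.abs_sum_le_sum_abs _ _).trans ((Finset.sum_le_card_nsmul _ _ 1
    fun h _ => hf₁ h).trans ?_)
  rw [nsmul_eq_mul, mul_one]
  refine le_trans (le_of_eq ?_) (Nat.cast_le.2 hq)
  rw [← Set.ncard_coe_finset]
  congr 2
  ext h
  simp [and_comm]

/-- Flipping a component preserves both colours at every site, so good vertices stay good; by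
maximality of their number no new ones arise. All other touched vertices are then monochromatic
under every flip, which makes `touchDiff` a signed sum over components, just like the difference of
edge counts. -/
theorem exists_balanced_coloring [Fintype N] [Fintype V] (p : N × Bool → V) (𝒦 : Set (Set V))
    (hd : ∀ K ∈ 𝒦, ∀ L ∈ 𝒦, ∀ v ∈ K, v ∈ L → K = L) (χ : N → Bool) (hχ : TouchesAll p 𝒦 χ) :
    ∃ χ' : N → Bool, TouchesAll p 𝒦 χ' ∧ |∑ e, boolSign (χ' e)| ≤ 1 ∧
      |touchDiff p χ' - ∑ e, boolSign (χ' e)| ≤ 2 ∧ |touchDiff p χ'| ≤ 2 := by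
  classical
  let good (χ : N → Bool) : Set V := {v | ∀ b, IsTouched p χ b v}
  obtain ⟨χ₀, h₀, hmax⟩ : ∃ χ₀, TouchesAll p 𝒦 χ₀ ∧
      ∀ χ', TouchesAll p 𝒦 χ' → (good χ').ncard ≤ (good χ₀).ncard := by
    obtain ⟨χ₀, h, h'⟩ := Set.exists_max_image {χ | TouchesAll p 𝒦 χ} (fun χ => (good χ).ncard)
      (Set.toFinite _) ⟨χ, hχ⟩
    exact ⟨χ₀, h, h'⟩
  -- The sites: good vertices, and members of `𝒦` without good vertices.
  let 𝒮 : Set (Set V) := {L | (∃ v ∈ good χ₀, L = {v}) ∨ (L ∈ 𝒦 ∧ ∀ v ∈ L, v ∉ good χ₀)}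
  have h𝒮 : ∀ L ∈ 𝒮, ∀ L' ∈ 𝒮, ∀ v ∈ L, v ∈ L' → L = L' := by
    rintro L (⟨u, hu, rfl⟩ | ⟨hL, hL'⟩) L' (⟨w, hw, rfl⟩ | ⟨hM, hM'⟩) v hv hv'
    · rw [← Set.mem_singleton_iff.1 hv, ← Set.mem_singleton_iff.1 hv']
    · rw [Set.mem_singleton_iff.1 hv] at hv'
      exact absurd hu (hM' _ hv')
    · rw [Set.mem_singleton_iff.1 hv'] at hv
      exact absurd hw (hL' _ hv)
    · exact hd _ hL _ hM v hv hv'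
  have hex : ∀ (L : 𝒮) (b : Bool), ∃ h, p h ∈ L.1 ∧ χ₀ h.1 = b := by
    rintro ⟨L, ⟨v, hv, rfl⟩ | ⟨hL, -⟩⟩ b
    · obtain ⟨h, h₁, h₂⟩ := hv b
      exact ⟨h, h₁, h₂⟩
    · obtain ⟨v, hv, h, rfl, h₂⟩ := h₀ L hL b
      exact ⟨h, hv, h₂⟩
  choose g hgL hgχ using hex
  have hg : ∀ i j b c, g i b = g j c → i = j ∧ b = c := by
    intro i j b c h
    refine ⟨Subtype.ext (h𝒮 _ i.2 _ j.2 _ (hgL i b) (h ▸ hgL j c)), ?_⟩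
    rw [← hgχ i b, h, hgχ j c]
  have : Fintype 𝒮 := Fintype.ofFinite _
  obtain ⟨π, hπ, hfree⟩ := exists_labelling g hg Finset.univ
  simp only [Finset.mem_univ, true_implies] at hπ hfree
  -- `s` decides for each component whether its colours are kept or all reversed.
  let flip (s : N → Bool) (e : N) : Bool := s (π e) == χ₀ e
  have hflip : ∀ s (L : 𝒮) b, ∃ b', flip s (g L b').1 = b := by
    intro s L b
    simp only [flip, hgχ]
    cases hs : s (π (g L true).1) <;> cases b
    · exact ⟨true, by simp [hs]⟩
    · exact ⟨false, by simp [← hπ, hs]⟩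
    · exact ⟨false, by simp [← hπ, hs]⟩
    · exact ⟨true, by simp [hs]⟩
  have hsub : ∀ s, good χ₀ ⊆ good (flip s) := by
    intro s v hv b
    obtain ⟨b', hb'⟩ := hflip s ⟨{v}, .inl ⟨v, hv, rfl⟩⟩ b
    exact ⟨_, hgL ⟨{v}, .inl ⟨v, hv, rfl⟩⟩ b', hb'⟩
  have hvalid : ∀ s, TouchesAll p 𝒦 (flip s) := by
    intro s K hK b
    by_cases h : ∃ v ∈ K, v ∈ good χ₀
    · obtain ⟨v, hv, hv'⟩ := h
      exact ⟨v, hv, hsub s hv' b⟩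
    · push Not at h
      obtain ⟨b', hb'⟩ := hflip s ⟨K, .inr ⟨hK, h⟩⟩ b
      exact ⟨_, hgL ⟨K, .inr ⟨hK, h⟩⟩ b', _, rfl, hb'⟩
  have hgood : ∀ s, good (flip s) = good χ₀ := fun s =>
    (Set.eq_of_subset_of_ncard_le (hsub s) (hmax _ (hvalid s))).symm
  have hrep : ∀ v, (∃ h, p h = v) →
      ∃ h, p h = v ∧ ((∃ i b, p (g i b) = v) → ∃ i b, g i b = h) := by
    rintro v ⟨h, hv⟩
    by_cases h₁ : ∃ i b, p (g i b) = v
    · obtain ⟨i, b, h₁⟩ := h₁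
      exact ⟨g i b, h₁, fun _ => ⟨i, b, rfl⟩⟩
    · exact ⟨h, hv, fun h => absurd h h₁⟩
  choose rep hrep hrep' using hrep
  -- The weight selects one half-edge at each touched vertex that is not good. Since `rep` prefers
  -- paired half-edges, paired half-edges get equal weight: 0 at a good vertex, 1 in a set without
  -- good vertices.
  let w (h : N × Bool) : ℤ := if p h ∉ good χ₀ ∧ rep (p h) ⟨h, rfl⟩ = h then 1 else 0
  have hw : ∀ i, w (g i true) = w (g i false) := by
    rintro ⟨L, ⟨v, hv, rfl⟩ | ⟨hL, hL'⟩⟩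
    · have h : ∀ b, w (g ⟨{v}, .inl ⟨v, hv, rfl⟩⟩ b) = 0 := fun b => by
        have := hgL ⟨{v}, .inl ⟨v, hv, rfl⟩⟩ b
        rw [Set.mem_singleton_iff] at this
        simp [w, this, hv]
      rw [h, h]
    · have h : ∀ b, w (g ⟨L, .inr ⟨hL, hL'⟩⟩ b) = 1 := fun b => by
        set i : 𝒮 := ⟨L, .inr ⟨hL, hL'⟩⟩ with hi
        have hb : p (g i b) ∉ good χ₀ := hL' _ (hgL i b)
        obtain ⟨j, c, hj⟩ := hrep' (p (g i b)) ⟨_, rfl⟩ ⟨i, b, rfl⟩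
        have hpj : p (g j c) = p (g i b) := by rw [hj, hrep]
        have hij : j = i := Subtype.ext (h𝒮 _ j.2 _ i.2 _ (hgL j c) (hpj ▸ hgL i b))
        subst hij
        -- Otherwise half-edges of opposite colours would meet at this vertex and make it good.
        have hcb : c = b := by
          by_contra hcb
          refine hb fun d => ?_
          by_cases hd : d = b
          · exact ⟨_, rfl, by rw [hgχ, hd]⟩
          · refine ⟨_, hpj, ?_⟩
            rw [hgχ]
            revert hcb hd
            cases b <;> cases c <;> cases d <;> simp
        subst hcb
        exact if_pos ⟨hb, hj.symm⟩
      rw [h, h]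
  have hmono : ∀ s h h', p h ∉ good χ₀ → p h = p h' → flip s h.1 = flip s h'.1 := by
    intro s h h' hv hp
    by_contra hne
    rw [← hgood s] at hv
    refine hv fun b => ?_
    by_cases hb : flip s h.1 = b
    · exact ⟨h, rfl, hb⟩
    · refine ⟨h', hp.symm, ?_⟩
      revert hne hb
      generalize flip s h.1 = x
      generalize flip s h'.1 = y
      cases x <;> cases y <;> cases b <;> simp
  have hdiff : ∀ s, touchDiff p (flip s) = ∑ h, w h * boolSign (flip s h.1) := by
    intro s
    rw [← Finset.sum_fiberwise Finset.univ p, touchDiff]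
    refine Finset.sum_congr rfl fun v _ => ?_
    by_cases hv : v ∈ good χ₀
    · have hv' := hsub s hv
      rw [if_pos (hv' true), if_pos (hv' false), sub_self]
      refine (Finset.sum_eq_zero fun h hh => ?_).symm
      simp only [Finset.mem_filter, Finset.mem_univ, true_and] at hh
      simp [w, hh, hv]
    by_cases ht : ∃ h, p h = v
    · have hr := hrep v ht
      have hv' : p (rep v ht) ∉ good χ₀ := by rwa [hr]
      rw [Finset.sum_eq_single (rep v ht)]
      · have hcol : ∀ b, IsTouched p (flip s) b v ↔ flip s (rep v ht).1 = b := fun b =>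
          ⟨fun ⟨h, h₁, h₂⟩ => (hmono s _ h hv' (hr.trans h₁.symm)).trans h₂,
            fun h => ⟨_, hr, h⟩⟩
        have hw1 : w (rep v ht) = 1 := if_pos ⟨hv', by simp only [hr]⟩
        rw [hw1]
        simp only [hcol]
        cases flip s (rep v ht).1 <;> simp [boolSign]
      · intro h hh hne
        simp only [Finset.mem_filter, Finset.mem_univ, true_and] at hh
        have : w h = 0 := if_neg fun h' => hne (by subst hh; exact h'.2.symm)
        rw [this, zero_mul]
      · intro h
        simp [hr] at h
    · have h₁ : ∀ b, ¬ IsTouched p (flip s) b v := fun b ⟨h, h', _⟩ => ht ⟨h, h'⟩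
      rw [if_neg (h₁ _), if_neg (h₁ _), sub_self]
      refine (Finset.sum_eq_zero fun h hh => absurd ⟨h, ?_⟩ ht).symm
      simpa using hh
  let x (q : N) : ℤ := ∑ e with π e = q, boolSign (χ₀ e)
  let y (q : N) : ℤ := ∑ h with π h.1 = q, w h * boolSign (χ₀ h.1)
  have hx2 : ∀ q, ∑ h : N × Bool with π h.1 = q, boolSign (χ₀ h.1) = 2 * x q := by
    intro q
    simp only [x, Finset.sum_filter, Fintype.sum_prod_type, Fintype.sum_bool, ← two_mul,
      Finset.mul_sum]
  have hpair : ∀ i, boolSign (χ₀ (g i true).1) = -boolSign (χ₀ (g i false).1) := by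
    intro i
    rw [hgχ, hgχ]
    rfl
  have hx : ∀ q, |x q| ≤ 1 := by
    intro q
    have := abs_sum_le_two_of_paired g hg π hπ q (hfree q) (fun h => boolSign (χ₀ h.1)) hpair
      (fun h => (abs_boolSign _).le)
    rw [hx2, abs_mul, abs_two] at this
    linarith
  have hz : ∀ q, |y q - x q| ≤ 1 := by
    intro q
    -- Summing over half-edges counts each edge twice, so `y q - x q` is half the sum with
    -- coefficients 2w - 1, which are ±1 and agree on pairs.
    have := abs_sum_le_two_of_paired g hg π hπ q (hfree q)
      (fun h => (2 * w h - 1) * boolSign (χ₀ h.1)) (fun i => by rw [hpair, hw]; ring)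
      (fun h => by
        rw [abs_mul, abs_boolSign, mul_one]
        by_cases h' : p h ∉ good χ₀ ∧ rep (p h) ⟨h, rfl⟩ = h <;> simp [w, h'])
    have h2 : ∑ h : N × Bool with π h.1 = q, (2 * w h - 1) * boolSign (χ₀ h.1) =
        2 * (y q - x q) := by
      rw [mul_sub, ← hx2, Finset.mul_sum, ← Finset.sum_sub_distrib]
      exact Finset.sum_congr rfl fun h _ => by ring
    rw [h2, abs_mul, abs_two] at this
    linarith
  obtain ⟨X, Z, ⟨s, hsX, hsZ⟩, h₁, h₂, h₃⟩ := exists_signs x (fun q => y q - x q) hx hz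
  have hX : ∑ e, boolSign (flip s e) = X := by
    rw [← hsX, ← Finset.sum_fiberwise Finset.univ π]
    refine Finset.sum_congr rfl fun q _ => ?_
    rw [Finset.mul_sum]
    refine Finset.sum_congr rfl fun e he => ?_
    simp only [Finset.mem_filter, Finset.mem_univ, true_and] at he
    rw [boolSign_beq, he, mul_comm]
  have hY : touchDiff p (flip s) = X + Z := by
    rw [hdiff, ← hsX, ← hsZ, ← Finset.sum_add_distrib,
      ← Finset.sum_fiberwise Finset.univ (fun h : N × Bool => π h.1)]
    refine Finset.sum_congr rfl fun q _ => ?_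
    rw [← mul_add, add_sub_cancel, Finset.mul_sum]
    refine Finset.sum_congr rfl fun h hh => ?_
    simp only [Finset.mem_filter, Finset.mem_univ, true_and] at hh
    rw [boolSign_beq, hh]
    ring
  exact ⟨flip s, hvalid s, by rwa [hX], by rwa [hX, hY, add_sub_cancel_left], by rwa [hY]⟩

end Coloring

/-! ### Edmonds' theorem, by Lovász's argument -/

section Branchings

variable {V A ι : Type*}

open Classical in
/-- The arcs of `D` that enter `X`. -/
noncomputable def enteringArcs (tail head : A → V) (D : Finset A) (X : Set V) : Finset A :=
  {a ∈ D | head a ∈ X ∧ tail a ∉ X}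

open Classical in
/-- The number of members of the family `R` that miss `X`. -/
noncomputable def missCount [Fintype ι] (R : ι → Set V) (X : Set V) : ℕ :=
  ∑ i, if Disjoint (R i) X then 1 else 0

/-- The arc set `B` is a spanning branching with root set `R`. -/
def IsBranching (tail head : A → V) (B : Finset A) (R : Set V) : Prop :=
  (∃ r : V → ℕ, (∀ a ∈ B, r (tail a) < r (head a)) ∧ ∀ v ∈ R, r v = 0) ∧
    ∀ v ∉ R, ∃! a, a ∈ B ∧ head a = v

theorem mem_enteringArcs {tail head : A → V} {D : Finset A} {X : Set V} {a : A} :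
    a ∈ enteringArcs tail head D X ↔ a ∈ D ∧ head a ∈ X ∧ tail a ∉ X := by
  simp [enteringArcs]

theorem card_enteringArcs_inter_add_union_le (tail head : A → V) (D : Finset A) (X Y : Set V) :
    (enteringArcs tail head D (X ∩ Y)).card + (enteringArcs tail head D (X ∪ Y)).card ≤
      (enteringArcs tail head D X).card + (enteringArcs tail head D Y).card := by
  classical
  simp only [enteringArcs, Finset.card_filter, ← Finset.sum_add_distrib]
  refine Finset.sum_le_sum fun a _ => ?_
  simp only [Set.mem_inter_iff, Set.mem_union]
  by_cases h₁ : head a ∈ X <;> by_cases h₂ : head a ∈ Y <;> by_cases h₃ : tail a ∈ X <;>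
    by_cases h₄ : tail a ∈ Y <;> simp [h₁, h₂, h₃, h₄]

theorem missCount_lt [Fintype ι] (R : ι → Set V) {X Y : Set V} (h : X ⊆ Y) (i : ι)
    (hX : Disjoint (R i) X) (hY : ¬ Disjoint (R i) Y) : missCount R Y < missCount R X := by
  refine Finset.sum_lt_sum (fun j _ => ?_) ⟨i, Finset.mem_univ _, by simp [hX, hY]⟩
  by_cases h' : Disjoint (R j) Y
  · simp [h', h'.mono_right h]
  · simp [h']

theorem missCount_add_le [Fintype ι] (R : ι → Set V) (X Y : Set V) :
    missCount R X + missCount R Y ≤ missCount R (X ∩ Y) + missCount R (X ∪ Y) := by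
  simp only [missCount, ← Finset.sum_add_distrib]
  refine Finset.sum_le_sum fun i _ => ?_
  by_cases h₁ : Disjoint (R i) X <;> by_cases h₂ : Disjoint (R i) Y
  · simp [h₁, h₂, h₁.mono_right (Set.inter_subset_left (t := Y))]
  · simp [h₁, h₂, h₁.mono_right (Set.inter_subset_left (t := Y))]
  · simp [h₁, h₂, h₂.mono_right (Set.inter_subset_right (s := X))]
  · simp [h₁, h₂]

/-- The inequality of `missCount_add_le` is strict because `R i` is counted for the intersection but
for neither of the two sets. -/
theorem missCount_add_lt [Fintype ι] (R : ι → Set V) (X Y : Set V) (i : ι)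
    (hX : ¬ Disjoint (R i) X) (hY : ¬ Disjoint (R i) Y) (hXY : Disjoint (R i) (X ∩ Y)) :
    missCount R X + missCount R Y < missCount R (X ∩ Y) + missCount R (X ∪ Y) := by
  simp only [missCount, ← Finset.sum_add_distrib]
  refine Finset.sum_lt_sum (fun j _ => ?_) ⟨i, Finset.mem_univ _, by simp [hX, hY, hXY]⟩
  by_cases h₁ : Disjoint (R j) X <;> by_cases h₂ : Disjoint (R j) Y
  · simp [h₁, h₂, h₁.mono_right (Set.inter_subset_left (t := Y))]
  · simp [h₁, h₂, h₁.mono_right (Set.inter_subset_left (t := Y))]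
  · simp [h₁, h₂, h₂.mono_right (Set.inter_subset_right (s := X))]
  · simp [h₁, h₂]

theorem missCount_antitone [Fintype ι] {R S : ι → Set V} (h : ∀ i, R i ⊆ S i) (X : Set V) :
    missCount S X ≤ missCount R X := by
  refine Finset.sum_le_sum fun j _ => ?_
  by_cases h' : Disjoint (S j) X
  · simp [h', h'.mono_left (h j)]
  · simp [h']

theorem missCount_lt_of_subset [Fintype ι] {R S : ι → Set V} (h : ∀ i, R i ⊆ S i) (X : Set V)
    (i : ι) (hS : ¬ Disjoint (S i) X) (hR : Disjoint (R i) X) : missCount S X < missCount R X := by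
  refine Finset.sum_lt_sum (fun j _ => ?_) ⟨i, Finset.mem_univ _, by simp [hR, hS]⟩
  by_cases h' : Disjoint (S j) X
  · simp [h', h'.mono_left (h j)]
  · simp [h']

theorem subset_update_insert [DecidableEq ι] (R : ι → Set V) (i : ι) (v : V) (j : ι) :
    R j ⊆ Function.update R i (insert v (R i)) j := by
  by_cases h : j = i
  · subst h
    simp
  · simp [h]

/-- An arc from `R` to a vertex `v` outside of `R` can be added to a branching with root set
`insert v R`. -/
theorem IsBranching.insert_arc [DecidableEq A] {tail head : A → V} {B : Finset A} {R : Set V}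
    {a : A} (htail : tail a ∈ R) (hhead : head a ∉ R)
    (h : IsBranching tail head B (insert (head a) R)) : IsBranching tail head (insert a B) R := by
  classical
  obtain ⟨⟨r, hr, hr0⟩, huniq⟩ := h
  -- Ranks off `R` are raised by one: the new arc's head was a root of rank 0 and must now lie above
  -- its tail.
  refine ⟨⟨fun v => if v ∈ R then 0 else r v + 1, ?_, fun v hv => if_pos hv⟩, ?_⟩
  · intro c hc
    rcases Finset.mem_insert.1 hc with rfl | hc
    · simp [htail, hhead]
    · have hlt := hr c hc
      have : head c ∉ R := fun h => by
        rw [hr0 _ (Set.mem_insert_of_mem _ h)] at hlt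
        omega
      simp only [this, if_false]
      split_ifs <;> omega
  · intro v hv
    by_cases hva : v = head a
    · refine ⟨a, by simp [hva], ?_⟩
      rintro c ⟨hc, hcv⟩
      rcases Finset.mem_insert.1 hc with rfl | hc
      · rfl
      · have := hr c hc
        rw [hcv, hva, hr0 _ (Set.mem_insert _ _)] at this
        omega
    · obtain ⟨c, ⟨hc, hcv⟩, hu⟩ := huniq v (by simp [hva, hv])
      refine ⟨c, ⟨by simp [hc], hcv⟩, ?_⟩
      rintro d ⟨hd, hdv⟩
      rcases Finset.mem_insert.1 hd with rfl | hd
      · exact absurd hdv.symm hva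
      · exact hu d ⟨hd, hdv⟩

/-- If every set `W` is entered by as many arcs as there are root sets that miss it, then a root set
`R i ≠ V` can be extended along an arc that is then deleted. -/
theorem exists_extending_arc [Finite V] [Fintype ι] [DecidableEq ι] [DecidableEq A]
    (tail head : A → V) (D : Finset A) (R : ι → Set V)
    (h : ∀ X : Set V, X.Nonempty → missCount R X ≤ (enteringArcs tail head D X).card) (i : ι)
    (hi : R i ≠ Set.univ) :
    ∃ a ∈ D, tail a ∈ R i ∧ head a ∉ R i ∧ ∀ X : Set V, X.Nonempty →
      missCount (Function.update R i (insert (head a) (R i))) X ≤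
        (enteringArcs tail head (D.erase a) X).card := by
  obtain ⟨v, hv⟩ : ∃ v, v ∉ R i := by
    by_contra! h
    exact hi (Set.eq_univ_of_forall h)
  let P (W : Set V) : Prop := ¬ Disjoint (R i) W ∧ (W \ R i).Nonempty ∧
    missCount R W = (enteringArcs tail head D W).card
  have hP : P Set.univ := by
    have h₀ : (enteringArcs tail head D Set.univ).card = 0 := by simp [enteringArcs]
    have h₁ := h Set.univ ⟨v, trivial⟩
    refine ⟨fun hd => ?_, ⟨v, trivial, hv⟩, by omega⟩
    have h₂ : 0 < missCount R Set.univ := Finset.sum_pos' (fun _ _ => Nat.zero_le _)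
      ⟨i, Finset.mem_univ i, by rw [if_pos hd]; exact one_pos⟩
    omega
  -- Inside a minimal tight set `W`, the part outside `R i` is missed by more root sets, hence
  -- entered by more arcs; an extra one must start in `W ∩ R i`.
  obtain ⟨W, ⟨hW₁, hW₂, hW₃⟩, hmin⟩ := exists_minimal_of_wellFoundedLT P ⟨_, hP⟩
  have hlt : (enteringArcs tail head D W).card < (enteringArcs tail head D (W \ R i)).card :=
    hW₃ ▸ (missCount_lt R Set.sdiff_subset i Set.disjoint_sdiff_right hW₁).trans_le (h _ hW₂)
  obtain ⟨a, ha, ha'⟩ := Finset.exists_mem_notMem_of_card_lt_card hlt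
  rw [mem_enteringArcs] at ha ha'
  obtain ⟨haD, ⟨haW, haR⟩, hat⟩ := ha
  have htW : tail a ∈ W := by
    by_contra hc
    exact ha' ⟨haD, haW, hc⟩
  have htR : tail a ∈ R i := by
    by_contra hc
    exact hat ⟨htW, hc⟩
  refine ⟨a, haD, htR, haR, fun X hX => ?_⟩
  have herase : enteringArcs tail head (D.erase a) X = (enteringArcs tail head D X).erase a := by
    ext c
    simp [mem_enteringArcs, and_assoc]
  rw [herase]
  by_cases haX : a ∈ enteringArcs tail head D X
  · rw [Finset.card_erase_of_mem haX]
    rw [mem_enteringArcs] at haX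
    obtain ⟨-, hhX, htX⟩ := haX
    have hle := h X hX
    by_cases hdX : Disjoint (R i) X
    · have := missCount_lt_of_subset (subset_update_insert R i (head a)) X i
        (Set.not_disjoint_iff.2 ⟨_, by simp, hhX⟩) hdX
      omega
    · have hle' := missCount_antitone (subset_update_insert R i (head a)) X
      suffices missCount R X ≠ (enteringArcs tail head D X).card by omega
      -- Uncrossing: if the arc entered a tight set `X` meeting `R i`, then `X ∩ W` would satisfy
      -- `P` too, yet it lacks the tail of the arc, against minimality of `W`.
      intro htight
      have h₁ := card_enteringArcs_inter_add_union_le tail head D X W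
      have h₂ := missCount_add_le R X W
      have h₃ := h (X ∩ W) ⟨_, hhX, haW⟩
      have h₄ := h (X ∪ W) ⟨_, .inl hhX⟩
      have hPXW : P (X ∩ W) := by
        refine ⟨fun hd => ?_, ⟨_, ⟨hhX, haW⟩, haR⟩, by omega⟩
        have := missCount_add_lt R X W i hdX hW₁ hd
        omega
      exact htX (hmin hPXW Set.inter_subset_right htW).1
  · rw [Finset.erase_eq_of_notMem haX]
    exact (missCount_antitone (subset_update_insert R i _) X).trans (h X hX)

/-- **Edmonds' disjoint branchings theorem.** -/
theorem exists_disjoint_branchings [Finite V] [Fintype ι] (tail head : A → V) (D : Finset A)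
    (R : ι → Set V)
    (h : ∀ X : Set V, X.Nonempty → missCount R X ≤ (enteringArcs tail head D X).card) :
    ∃ B : ι → Finset A, (∀ i, B i ⊆ D) ∧ (∀ i j, i ≠ j → Disjoint (B i) (B j)) ∧
      ∀ i, IsBranching tail head (B i) (R i) := by
  classical
  induction hn : D.card using Nat.strong_induction_on generalizing D R with
  | h n ih =>
    by_cases hall : ∀ i, R i = Set.univ
    · refine ⟨fun _ => ∅, by simp, by simp, fun i => ⟨⟨fun _ => 0, by simp, by simp⟩, ?_⟩⟩
      simp [hall]
    · push Not at hall
      obtain ⟨i, hi⟩ := hall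
      obtain ⟨a, haD, hat, hah, ha⟩ := exists_extending_arc tail head D R h i hi
      obtain ⟨B, hBD, hBB, hB⟩ := ih _ (hn ▸ Finset.card_erase_lt_of_mem haD) (D.erase a) _ ha rfl
      have haB : ∀ j, a ∉ B j := fun j h => by simpa using hBD j h
      refine ⟨Function.update B i (insert a (B i)), fun j => ?_, fun j k hjk => ?_, fun j => ?_⟩
      · have := (hBD j).trans (Finset.erase_subset _ _)
        by_cases hj : j = i
        · subst hj
          simpa [Finset.insert_subset_iff, haD] using this
        · simpa [hj] using this
      · have := hBB j k hjk
        by_cases hj : j = i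
        · subst hj
          simpa [hjk.symm, haB] using this
        · by_cases hk : k = i
          · subst hk
            simpa [hj, haB] using this
          · simpa [hj, hk] using this
      · have := hB j
        by_cases hj : j = i
        · subst hj
          simp only [Function.update_self] at this ⊢
          exact this.insert_arc hat hah
        · simpa [hj] using this

end Branchings

/-! ### Covering forests and branchings -/

/-- A fixed point free self-map of a finite type has a cycle. -/
theorem exists_cycle_of_forall_ne {α : Type*} [Finite α] [Nonempty α] (f : α → α)
    (hf : ∀ x, f x ≠ x) :
    ∃ (n : ℕ) (v : Fin (n + 2) → α), Function.Injective v ∧ ∀ i, f (v i) = v (i + 1) := by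
  obtain ⟨x⟩ := ‹Nonempty α›
  obtain ⟨l, m, hne, heq⟩ := Finite.exists_ne_map_eq_of_infinite (fun n : ℕ => f^[n] x)
  wlog hlm : l < m generalizing l m
  · exact this m l hne.symm heq.symm (by omega)
  set y := f^[l] x with hy
  have hper : Function.IsPeriodicPt f (m - l) y := by
    change f^[m - l] (f^[l] x) = f^[l] x
    rw [← Function.iterate_add_apply, Nat.sub_add_cancel hlm.le]
    exact heq.symm
  have hpos := hper.minimalPeriod_pos (by omega)
  have hone : Function.minimalPeriod f y ≠ 1 := fun h =>
    hf y (Function.minimalPeriod_eq_one_iff_isFixedPt.1 h)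
  obtain ⟨n, hn⟩ : ∃ n, Function.minimalPeriod f y = n + 2 :=
    ⟨Function.minimalPeriod f y - 2, by omega⟩
  refine ⟨n, fun i => f^[i] y, fun i j hij => ?_, fun i => ?_⟩
  · exact Fin.ext (Function.iterate_injOn_Iio_minimalPeriod (by simp [hn]) (by simp [hn]) hij)
  · beta_reduce
    rw [← Function.iterate_succ_apply' f, Fin.val_add,
      ← Function.iterate_mod_minimalPeriod_eq, hn]
    simp

namespace MixedGraph

variable {V E A : Type*} (G : MixedGraph V E A)

/-- The endpoints of the edges in `M`. -/
def edgeVerts (M : Finset E) : Set V := {v | ∃ e ∈ M, v ∈ G.ends e}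

variable {G}

/-- If no arc enters `X`, each vertex of `X` is the head of an arc from within `X`; passing from
head to tail is a fixed point free self-map of `X`, whose cycle is a cycle of `F`. -/
theorem IsMixedCoveringForest.exists_entering [Finite V] {F : Finset (E ⊕ A)}
    (hF : G.IsMixedCoveringForest F) {X : Set V} (hX : X.Nonempty)
    (hd : Disjoint (G.edgeVerts F.toLeft) X) :
    (enteringArcs G.tail G.head F.toRight X).Nonempty := by
  by_contra! hempty
  have hin : ∀ v : X, ∃ a, Sum.inr a ∈ F ∧ G.head a = v ∧ G.tail a ∈ X := by
    intro v
    obtain ⟨e | a, hx, hhead⟩ := hF.covers v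
    · exact absurd v.2 (Set.disjoint_left.1 hd ⟨e, by simpa using hx, hhead⟩)
    · refine ⟨a, hx, hhead.symm, ?_⟩
      by_contra htail
      have : a ∈ enteringArcs G.tail G.head F.toRight X :=
        mem_enteringArcs.2 ⟨by simpa using hx, hhead ▸ v.2, htail⟩
      simp [hempty] at this
  choose a haF hah hat using hin
  have : Nonempty X := hX.to_subtype
  obtain ⟨n, v, hv, hstep⟩ := exists_cycle_of_forall_ne (fun v : X => (⟨_, hat v⟩ : X))
    fun v h => G.tail_ne_head (a v) (by rw [hah]; exact congrArg Subtype.val h)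
  refine hF.acyclic ⟨n, fun i => v i, fun i => .inr (a (v i)), Subtype.val_injective.comp hv,
    fun i j hij => hv (Subtype.ext ?_), fun i => ⟨haF _, ?_⟩⟩
  · rw [← hah, Sum.inr_injective hij, hah]
  · beta_reduce
    rw [← hstep, underlyingEnds, hah]
    exact Sym2.eq_swap

variable (G) in
/-- Disjoint branchings with root sets `G.edgeVerts (M b)` can be found in `D`. -/
def Packable (D : Finset A) (M : Bool → Finset E) : Prop :=
  ∀ X : Set V, X.Nonempty →
    missCount (fun b => G.edgeVerts (M b)) X ≤ (enteringArcs G.tail G.head D X).card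

theorem packable_of_isMixedCoveringForest [Finite V] [DecidableEq A] (F : Bool → Finset (E ⊕ A))
    (hF : ∀ b, G.IsMixedCoveringForest (F b)) (hd : Disjoint (F true) (F false)) :
    G.Packable ((F true).toRight ∪ (F false).toRight) (fun b => (F b).toLeft) := by
  classical
  intro X hX
  have hunion : enteringArcs G.tail G.head ((F true).toRight ∪ (F false).toRight) X =
      enteringArcs G.tail G.head (F true).toRight X ∪
        enteringArcs G.tail G.head (F false).toRight X := by
    ext a
    simp only [mem_enteringArcs, Finset.mem_union]
    tauto
  rw [hunion, Finset.card_union_of_disjoint, missCount, Fintype.sum_bool]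
  · have key : ∀ b, (if Disjoint (G.edgeVerts (F b).toLeft) X then 1 else 0) ≤
        (enteringArcs G.tail G.head (F b).toRight X).card := by
      intro b
      split_ifs with h
      · exact Finset.card_pos.2 ((hF b).exists_entering hX h)
      · exact Nat.zero_le _
    exact add_le_add (key true) (key false)
  · rw [Finset.disjoint_left]
    intro a h₁ h₂
    rw [mem_enteringArcs, Finset.mem_toRight] at h₁ h₂
    exact Finset.disjoint_left.1 hd h₁.1 h₂.1

/-- An edge set together with a branching rooted at its vertices has no cycle, unless an edge can be
removed without changing the set of vertices. -/
theorem exists_edgeVerts_erase_eq [DecidableEq E] {M : Finset E} {B : Finset A}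
    (hB : IsBranching G.tail G.head B (G.edgeVerts M)) (hc : G.HasCycle (M.disjSum B)) :
    ∃ e ∈ M, G.edgeVerts (M.erase e) = G.edgeVerts M := by
  obtain ⟨⟨r, hr, hr0⟩, huniq⟩ := hB
  obtain ⟨n, v, x, hv, hx, hvx⟩ := hc
  have hprev : ∀ i, G.underlyingEnds (x (i - 1)) = s(v i, v (i - 1)) := fun i => by
    rw [(hvx (i - 1)).2, sub_add_cancel, Sym2.eq_swap]
  have hne : ∀ i : Fin (n + 2), i - 1 ≠ i := fun i h => by simp at h
  -- Consider a vertex of largest rank on the cycle. If the rank is 0, the cycle has only edges and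
  -- any of them is redundant; otherwise both cycle elements there are arcs entering a non-root,
  -- contradicting uniqueness.
  obtain ⟨i, hi⟩ := Finite.exists_max (fun i => r (v i))
  rcases Nat.eq_zero_or_pos (r (v i)) with h0 | hpos
  · have hedge : ∀ j, ∃ e ∈ M, x j = .inl e := by
      intro j
      obtain ⟨hj, hj'⟩ := hvx j
      rcases hxj : x j with e | a
      · exact ⟨e, by simpa [hxj] using hj, rfl⟩
      · rw [hxj] at hj hj'
        have h₁ := hr a (by simpa using hj)
        have h₂ : G.head a ∈ s(v j, v (j + 1)) := by
          rw [← hj']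
          exact Sym2.mem_mk_right _ _
        rw [h0] at hi
        rcases Sym2.mem_iff.1 h₂ with h | h
        · have := hi j
          rw [← h] at this
          omega
        · have := hi (j + 1)
          rw [← h] at this
          omega
    choose e heM he using hedge
    have hends : ∀ j, v j ∈ G.ends (e j) ∧ v (j + 1) ∈ G.ends (e j) := fun j => by
      have : G.ends (e j) = s(v j, v (j + 1)) := by
        rw [← (hvx j).2, he]
        rfl
      simp [this]
    have hinj : ∀ j k, j ≠ k → e j ≠ e k := fun j k hjk h => hjk (hx (by rw [he, he, h]))
    refine ⟨e 0, heM 0, Set.Subset.antisymm ?_ ?_⟩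
    · rintro w ⟨f, hf, hw⟩
      exact ⟨f, Finset.mem_of_mem_erase hf, hw⟩
    · rintro w ⟨f, hf, hw⟩
      by_cases hfe : f = e 0
      · subst hfe
        have h₀ : G.ends (e 0) = s(v 0, v (0 + 1)) := by
          rw [← (hvx 0).2, he]
          rfl
        rw [h₀, Sym2.mem_iff] at hw
        rcases hw with rfl | rfl
        · refine ⟨e (0 - 1), Finset.mem_erase.2 ⟨hinj _ _ (hne 0), heM _⟩, ?_⟩
          simpa only [sub_add_cancel] using (hends (0 - 1)).2
        · exact ⟨e (0 + 1), Finset.mem_erase.2 ⟨hinj _ _ (by simp), heM _⟩, (hends _).1⟩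
      · exact ⟨f, Finset.mem_erase.2 ⟨hfe, hf⟩, hw⟩
  · have hnot : v i ∉ G.edgeVerts M := fun h => by
      rw [hr0 _ h] at hpos
      omega
    have key : ∀ y ∈ M.disjSum B, ∀ j, G.underlyingEnds y = s(v i, v j) →
        ∃ a, (a ∈ B ∧ G.head a = v i) ∧ y = .inr a := by
      rintro (e | a) hy j hj
      · refine absurd ⟨e, by simpa using hy, ?_⟩ hnot
        change G.ends e = _ at hj
        simp [hj]
      · have ha : a ∈ B := by simpa using hy
        refine ⟨a, ⟨ha, ?_⟩, rfl⟩
        rcases Sym2.eq_iff.1 hj with ⟨h₁, h₂⟩ | ⟨h₁, h₂⟩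
        · have h₃ := hr a ha
          have h₄ := hi j
          rw [h₁, h₂] at h₃
          omega
        · exact h₂
    obtain ⟨a, ha, hxa⟩ := key _ (hvx i).1 _ (hvx i).2
    obtain ⟨b, hb, hxb⟩ := key _ (hvx (i - 1)).1 _ (hprev i)
    exact absurd (hx (hxb.trans ((huniq _ hnot).unique hb ha ▸ hxa.symm))) (hne i)

theorem isMixedCoveringForest_disjSum {M : Finset E} {B : Finset A}
    (hB : IsBranching G.tail G.head B (G.edgeVerts M)) (hc : ¬ G.HasCycle (M.disjSum B)) :
    G.IsMixedCoveringForest (M.disjSum B) := by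
  refine ⟨hc, fun v => ?_⟩
  by_cases hv : v ∈ G.edgeVerts M
  · obtain ⟨e, he, hve⟩ := hv
    exact ⟨.inl e, by simpa using he, hve⟩
  · obtain ⟨a, ⟨ha, hav⟩, -⟩ := hB.2 v hv
    exact ⟨.inr a, by simpa using ha, hav.symm⟩

end MixedGraph

/-- Taking heads is a bijection from the arcs to the non-roots; no arc enters a root, because roots
have rank 0. -/
theorem IsBranching.card_add_ncard {V A : Type*} [Finite V] {tail head : A → V} {B : Finset A}
    {R : Set V} (h : IsBranching tail head B R) : B.card + R.ncard = Nat.card V := by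
  obtain ⟨⟨r, hr, hr0⟩, huniq⟩ := h
  have hR : ∀ a ∈ B, head a ∉ R := fun a ha h => by
    have := hr a ha
    rw [hr0 _ h] at this
    omega
  rw [← Set.ncard_add_ncard_compl R, add_comm, ← Set.ncard_coe_finset]
  congr 1
  refine Set.ncard_congr (fun a _ => head a) (fun a ha => hR a ha)
    (fun a b ha hb hab => (huniq _ (hR a ha)).unique ⟨ha, rfl⟩ ⟨hb, hab.symm⟩) fun v hv => ?_
  obtain ⟨a, ⟨ha, hav⟩, -⟩ := huniq v hv
  exact ⟨a, ha, hav⟩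

theorem missCount_bool_le_two {V : Type*} (R : Bool → Set V) (X : Set V) : missCount R X ≤ 2 := by
  simp only [missCount, Fintype.sum_bool]
  split_ifs <;> simp

theorem missCount_bool_le_one {V : Type*} (R : Bool → Set V) (X : Set V) (b : Bool)
    (hb : ¬ Disjoint (R b) X) : missCount R X ≤ 1 := by
  simp only [missCount, Fintype.sum_bool]
  cases b <;> simp only [hb, if_false] <;> split_ifs <;> simp

theorem missCount_eq_zero_iff {V ι : Type*} [Fintype ι] (R : ι → Set V) (X : Set V) :
    missCount R X = 0 ↔ ∀ i, ¬ Disjoint (R i) X := by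
  simp [missCount]

/-! ### Balancing two forests -/

namespace MixedGraph

variable {V E A : Type*} {G : MixedGraph V E A}

/-- The sets in which both of two disjoint branchings need a root. -/
def sources (G : MixedGraph V E A) (D : Finset A) : Set (Set V) :=
  {K | Minimal (fun X => X.Nonempty ∧ enteringArcs G.tail G.head D X = ∅) K}

theorem sources_eq_of_mem {D : Finset A} {K L : Set V} (hK : K ∈ G.sources D)
    (hL : L ∈ G.sources D) {v : V} (hvK : v ∈ K) (hvL : v ∈ L) : K = L := by
  have h : (K ∩ L).Nonempty ∧ enteringArcs G.tail G.head D (K ∩ L) = ∅ := by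
    refine ⟨⟨v, hvK, hvL⟩, ?_⟩
    have := card_enteringArcs_inter_add_union_le G.tail G.head D K L
    rw [hK.1.2, hL.1.2] at this
    rw [← Finset.card_eq_zero]
    simp only [Finset.card_empty] at this
    omega
  exact Set.Subset.antisymm (fun v hv => (hK.2 h Set.inter_subset_left hv).2)
    fun v hv => (hL.2 h Set.inter_subset_right hv).1

/-- A set with no entering arc contains a source, so both colours meet it. If some arc enters, one
missing colour is harmless; if both colours miss the set, then so did both old ones, and the old
condition supplies two arcs. -/
theorem Packable.of_sources [Finite V] {D : Finset A} {M M' : Bool → Finset E}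
    (hM : G.Packable D M) (hsub : ∀ b, ∀ e ∈ M b, ∃ b', e ∈ M' b')
    (h : ∀ K ∈ G.sources D, ∀ b, ¬ Disjoint (G.edgeVerts (M' b)) K) : G.Packable D M' := by
  intro X hX
  rcases Finset.eq_empty_or_nonempty (enteringArcs G.tail G.head D X) with h0 | h1
  · obtain ⟨K, hKX, hK⟩ := exists_minimal_le_of_wellFoundedLT
      (fun X => X.Nonempty ∧ enteringArcs G.tail G.head D X = ∅) X ⟨hX, h0⟩
    refine ((missCount_eq_zero_iff _ _).2 fun b hd => ?_).le.trans (Nat.zero_le _)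
    exact h K hK b (hd.mono_right hKX)
  · have hpos := Finset.card_pos.2 h1
    by_cases hall : ∀ b, Disjoint (G.edgeVerts (M' b)) X
    · have : missCount (fun b => G.edgeVerts (M b)) X = 2 := by
        have hd : ∀ b, Disjoint (G.edgeVerts (M b)) X := by
          intro b
          rw [Set.disjoint_left]
          rintro v ⟨e, he, hv⟩
          obtain ⟨b', hb'⟩ := hsub b e he
          exact Set.disjoint_left.1 (hall b') ⟨e, hb', hv⟩
        simp [missCount, hd]
      exact (missCount_bool_le_two _ _).trans (this ▸ hM X hX)
    · push Not at hall
      obtain ⟨b, hb⟩ := hall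
      exact (missCount_bool_le_one _ _ b hb).trans hpos

/-- Edges can be recoloured in a balanced way, after discarding redundant ones. -/
theorem Packable.exists_balanced [Finite V] [Finite E] [DecidableEq E] {D : Finset A}
    {M : Bool → Finset E} (hM : G.Packable D M) (hd : Disjoint (M true) (M false)) :
    ∃ M' : Bool → Finset E, G.Packable D M' ∧ Disjoint (M' true) (M' false) ∧
      (∀ b, M' b ⊆ M true ∪ M false) ∧
      (∀ b, ∀ e ∈ M' b, G.edgeVerts ((M' b).erase e) ≠ G.edgeVerts (M' b)) ∧
      |((M' true).card : ℤ) - (M' false).card| ≤ 1 ∧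
      |((G.edgeVerts (M' true)).ncard - (G.edgeVerts (M' false)).ncard : ℤ) -
        ((M' true).card - (M' false).card)| ≤ 2 ∧
      |((G.edgeVerts (M' true)).ncard : ℤ) - (G.edgeVerts (M' false)).ncard| ≤ 2 := by
  classical
  have := Fintype.ofFinite V
  have := Fintype.ofFinite E
  -- Using as few edges as possible rules out redundant edges. Recolouring keeps the total number,
  -- so minimality carries over to `cls χ`.
  obtain ⟨M₀, ⟨hM₀, hd₀, hsub₀⟩, hmin⟩ := Set.exists_min_image
    {M' : Bool → Finset E | G.Packable D M' ∧ Disjoint (M' true) (M' false) ∧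
      ∀ b, M' b ⊆ M true ∪ M false} (fun M' => (M' true).card + (M' false).card)
    (Set.toFinite _) ⟨M, hM, hd, Bool.rec Finset.subset_union_right Finset.subset_union_left⟩
  set U := M₀ true ∪ M₀ false with hU
  have hends : ∀ e, ∃ f : Bool → V, ∀ v, v ∈ G.ends e ↔ ∃ b, f b = v := by
    intro e
    induction G.ends e with
    | h x y => exact ⟨fun b => if b then x else y, fun v => by simp [eq_comm, or_comm]⟩
  choose f hf using hends
  let p (h : U × Bool) : V := f h.1 h.2
  let cls (χ : U → Bool) (b : Bool) : Finset E :=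
    ({e : U | χ e = b} : Finset U).map (Function.Embedding.subtype _)
  have hcls : ∀ χ b e, e ∈ cls χ b ↔ ∃ h : e ∈ U, χ ⟨e, h⟩ = b := by simp [cls]
  have hverts : ∀ χ b, G.edgeVerts (cls χ b) = {v | IsTouched p χ b v} := by
    intro χ b
    ext v
    constructor
    · rintro ⟨e, he, hv⟩
      obtain ⟨heU, he⟩ := (hcls _ _ _).1 he
      obtain ⟨c, hc⟩ := (hf e v).1 hv
      exact ⟨(⟨e, heU⟩, c), hc, he⟩
    · rintro ⟨⟨⟨e, heU⟩, c⟩, hc, he⟩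
      exact ⟨e, (hcls _ _ _).2 ⟨heU, he⟩, (hf e v).2 ⟨c, hc⟩⟩
  have hχ₀ : ∀ b, cls (fun e => decide (e.1 ∈ M₀ true)) b = M₀ b := by
    intro b
    ext e
    rw [hcls]
    have : e ∈ M₀ true → e ∉ M₀ false := fun h => Finset.disjoint_left.1 hd₀ h
    cases b <;> simp [hU] <;> tauto
  have hsource : ∀ χ, TouchesAll p (G.sources D) χ ↔
      ∀ K ∈ G.sources D, ∀ b, ¬ Disjoint (G.edgeVerts (cls χ b)) K := by
    intro χ
    simp only [TouchesAll, hverts, Set.not_disjoint_iff, Set.mem_ofPred_eq]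
    simp only [and_comm]
  obtain ⟨χ, hχ, h₁, h₂, h₃⟩ := exists_balanced_coloring p (G.sources D)
    (fun K hK L hL v hvK hvL => sources_eq_of_mem hK hL hvK hvL)
    (fun e => decide (e.1 ∈ M₀ true)) ((hsource _).2 fun K hK => by
      simp only [hχ₀]
      refine (missCount_eq_zero_iff (fun b => G.edgeVerts (M₀ b)) K).1 ?_
      have := hM₀ K hK.1.1
      rw [hK.1.2] at this
      simpa using this)
  have hpack : G.Packable D (cls χ) := hM₀.of_sources (fun b e he => by
    have heU : e ∈ U := by
      cases b
      · exact Finset.mem_union_right _ he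
      · exact Finset.mem_union_left _ he
    exact ⟨_, (hcls _ _ _).2 ⟨heU, rfl⟩⟩) ((hsource χ).1 hχ)
  have hclsd : Disjoint (cls χ true) (cls χ false) := by
    rw [Finset.disjoint_left]
    intro e h h'
    obtain ⟨_, h⟩ := (hcls _ _ _).1 h
    obtain ⟨_, h'⟩ := (hcls _ _ _).1 h'
    simp [h] at h'
  have hclssub : ∀ b, cls χ b ⊆ M true ∪ M false := by
    intro b e he
    obtain ⟨heU, -⟩ := (hcls _ _ _).1 he
    rcases Finset.mem_union.1 heU with h | h
    · exact hsub₀ _ h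
    · exact hsub₀ _ h
  have hcard : (cls χ true).card + (cls χ false).card = (M₀ true).card + (M₀ false).card := by
    rw [← Finset.card_union_of_disjoint hclsd, ← Finset.card_union_of_disjoint hd₀]
    congr 1
    ext e
    rw [Finset.mem_union, hcls, hcls]
    constructor
    · rintro (⟨h, -⟩ | ⟨h, -⟩) <;> exact h
    · intro h
      cases hc : χ ⟨e, h⟩
      · exact .inr ⟨h, hc⟩
      · exact .inl ⟨h, hc⟩
  have hedge : ∑ e, boolSign (χ e) = (cls χ true).card - (cls χ false).card := by
    simp only [cls, Finset.card_map, Finset.card_filter, Nat.cast_sum, ← Finset.sum_sub_distrib]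
    refine Finset.sum_congr rfl fun e _ => ?_
    cases χ e <;> simp [boolSign]
  have hvert : touchDiff p χ =
      (G.edgeVerts (cls χ true)).ncard - (G.edgeVerts (cls χ false)).ncard := by
    simp only [hverts, Set.ncard_eq_toFinset_card', Set.toFinset_ofPred, Finset.card_filter,
      Nat.cast_sum, ← Finset.sum_sub_distrib, touchDiff]
    simp
  rw [hvert] at h₂ h₃
  rw [hedge] at h₁ h₂
  refine ⟨cls χ, hpack, hclsd, hclssub, fun b e he heq => ?_, h₁, h₂, h₃⟩
  let M₁ := Function.update (cls χ) b ((cls χ b).erase e)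
  have hM₁ : ∀ c, M₁ c ⊆ cls χ c := by
    intro c
    by_cases hc : c = b
    · subst hc
      simp [M₁, Finset.erase_subset]
    · simp [M₁, hc]
  have hM₁v : ∀ c, G.edgeVerts (M₁ c) = G.edgeVerts (cls χ c) := by
    intro c
    by_cases hc : c = b
    · subst hc
      simp [M₁, heq]
    · simp [M₁, hc]
  have hlt : (M₁ true).card + (M₁ false).card < (cls χ true).card + (cls χ false).card := by
    have := Finset.card_erase_lt_of_mem he
    cases b <;> simp only [M₁, Function.update_self, ne_eq, reduceCtorEq, not_false_eq_true,
      Function.update_of_ne] <;> omega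
  have := hmin M₁ ⟨by simpa only [Packable, hM₁v] using hpack,
    hclsd.mono (hM₁ _) (hM₁ _), fun c => (hM₁ c).trans (hclssub c)⟩
  omega

/-- Two disjoint mixed covering forests can be replaced by a balanced pair. -/
theorem exists_balanced_pair [Finite V] [Finite E] (F : Bool → Finset (E ⊕ A))
    (hF : ∀ b, G.IsMixedCoveringForest (F b)) (hd : Disjoint (F true) (F false)) :
    ∃ F' : Bool → Finset (E ⊕ A), (∀ b, G.IsMixedCoveringForest (F' b)) ∧
      Disjoint (F' true) (F' false) ∧ (∀ b, ∀ x ∈ F' b, ∃ b', x ∈ F b') ∧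
      |((F' true).card : ℤ) - (F' false).card| ≤ 2 ∧
      |((F' true).toLeft.card : ℤ) - (F' false).toLeft.card| ≤ 1 ∧
      |((F' true).toRight.card : ℤ) - (F' false).toRight.card| ≤ 2 := by
  classical
  obtain ⟨M, hM, hMd, hMsub, hMmin, h₁, h₂, h₃⟩ :=
    (packable_of_isMixedCoveringForest F hF hd).exists_balanced (by
      rw [Finset.disjoint_left]
      intro e h h'
      exact Finset.disjoint_left.1 hd (Finset.mem_toLeft.1 h) (Finset.mem_toLeft.1 h'))
  obtain ⟨B, hBD, hBd, hB⟩ := exists_disjoint_branchings G.tail G.head _ _ hM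
  -- The arc difference is thus minus the root difference, and the difference of sizes is the edge
  -- difference minus the root difference.
  have hcard : ∀ b, ((B b).card : ℤ) = Nat.card V - (G.edgeVerts (M b)).ncard := fun b => by
    rw [← (hB b).card_add_ncard]
    simp
  refine ⟨fun b => (M b).disjSum (B b), fun b => isMixedCoveringForest_disjSum (hB b) fun hc => ?_,
    ?_, ?_, ?_, ?_, ?_⟩
  · obtain ⟨e, he, heq⟩ := exists_edgeVerts_erase_eq (hB b) hc
    exact hMmin b e he heq
  · rw [Finset.disjoint_left]
    rintro (e | a) h h'
    · exact Finset.disjoint_left.1 hMd (by simpa using h) (by simpa using h')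
    · exact Finset.disjoint_left.1 (hBd true false (by simp)) (by simpa using h) (by simpa using h')
  · rintro b (e | a) h
    · have := hMsub b (by simpa using h : e ∈ M b)
      rcases Finset.mem_union.1 this with h | h
      · exact ⟨_, Finset.mem_toLeft.1 h⟩
      · exact ⟨_, Finset.mem_toLeft.1 h⟩
    · have := hBD b (by simpa using h : a ∈ B b)
      rcases Finset.mem_union.1 this with h | h
      · exact ⟨_, Finset.mem_toRight.1 h⟩
      · exact ⟨_, Finset.mem_toRight.1 h⟩
  · simp only [Finset.card_disjSum, Nat.cast_add, hcard]
    rw [abs_le] at h₂ ⊢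
    constructor <;> linarith
  · simpa using h₁
  · simp only [Finset.toRight_disjSum, hcard]
    rw [abs_le] at h₃ ⊢
    constructor <;> linarith

end MixedGraph

/-! ### From pairs to k forests -/

/-- The sum of this over a family decreases when an unbalanced pair is replaced by a balanced one. -/
def imbalance {E A : Type*} (S : Finset (E ⊕ A)) : ℕ :=
  2 * S.toLeft.card ^ 2 + S.toRight.card ^ 2 + S.card ^ 2

/-- By 2(p² + q²) = (p + q)² + (p - q)², and since the sums do not grow, only differences matter.
With x and y the edge and arc differences, 2x² + y² + (x + y)² is at most 8 for balanced pairs and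
exceeds 8 for all others; the weight 2 handles |x| = 2. -/
theorem imbalance_lt {e₁ e₂ a₁ a₂ e₁' e₂' a₁' a₂' : ℕ} (he : e₁' + e₂' ≤ e₁ + e₂)
    (ha : a₁' + a₂' ≤ a₁ + a₂) (ht' : |((e₁' + a₁' : ℕ) : ℤ) - (e₂' + a₂' : ℕ)| ≤ 2)
    (he' : |(e₁' : ℤ) - e₂'| ≤ 1) (ha' : |(a₁' : ℤ) - a₂'| ≤ 2)
    (h : ¬ (|((e₁ + a₁ : ℕ) : ℤ) - (e₂ + a₂ : ℕ)| ≤ 2 ∧ |(e₁ : ℤ) - e₂| ≤ 1 ∧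
      |(a₁ : ℤ) - a₂| ≤ 2)) :
    (2 * e₁' ^ 2 + a₁' ^ 2 + (e₁' + a₁') ^ 2) + (2 * e₂' ^ 2 + a₂' ^ 2 + (e₂' + a₂') ^ 2) <
      (2 * e₁ ^ 2 + a₁ ^ 2 + (e₁ + a₁) ^ 2) + (2 * e₂ ^ 2 + a₂ ^ 2 + (e₂ + a₂) ^ 2) := by
  have key : ∀ x y : ℤ, |x| ≤ 1 → |y| ≤ 2 → |x + y| ≤ 2 →
      2 * x ^ 2 + y ^ 2 + (x + y) ^ 2 ≤ 8 := by
    intro x y hx hy hxy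
    rw [abs_le] at hx hy hxy
    obtain ⟨h₁, h₂⟩ := hx
    obtain ⟨h₃, h₄⟩ := hy
    revert hxy
    interval_cases x <;> interval_cases y <;> norm_num
  have key' : ∀ x y : ℤ, ¬ (|x + y| ≤ 2 ∧ |x| ≤ 1 ∧ |y| ≤ 2) →
      8 < 2 * x ^ 2 + y ^ 2 + (x + y) ^ 2 := by
    intro x y hxy
    by_contra! hle
    have hx : |x| ≤ 1 := by
      by_contra! hc
      have : 2 ^ 2 ≤ |x| ^ 2 := by gcongr; omega
      rw [sq_abs] at this
      nlinarith [sq_nonneg (x + 2 * y)]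
    have hy : |y| ≤ 2 := by
      by_contra! hc
      have : 3 ^ 2 ≤ |y| ^ 2 := by gcongr; omega
      rw [sq_abs] at this
      nlinarith [sq_nonneg (x + y)]
    have hs : |x + y| ≤ 2 := by
      by_contra! hc
      have : 3 ^ 2 ≤ |x + y| ^ 2 := by gcongr; omega
      rw [sq_abs] at this
      nlinarith [sq_nonneg x, sq_nonneg y]
    exact hxy ⟨hs, hx, hy⟩
  have h₁ := key ((e₁' : ℤ) - e₂') (a₁' - a₂') he' ha' (by
    push_cast at ht'
    convert ht' using 2
    ring)
  have h₂ := key' ((e₁ : ℤ) - e₂) (a₁ - a₂) (by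
    push_cast at h
    convert h using 4
    ring)
  zify at he ha ⊢
  have h₃ : ((e₁' : ℤ) + e₂') ^ 2 ≤ (e₁ + e₂) ^ 2 := by gcongr
  have h₄ : ((a₁' : ℤ) + a₂') ^ 2 ≤ (a₁ + a₂) ^ 2 := by gcongr
  have h₅ : ((e₁' : ℤ) + e₂' + (a₁' + a₂')) ^ 2 ≤ (e₁ + e₂ + (a₁ + a₂)) ^ 2 := by gcongr
  linarith

theorem card_add_card_le_of_subset_union {α : Type*} [DecidableEq α] {S T S' T' : Finset α}
    (hd : Disjoint S T) (hS : S ⊆ S' ∪ T') (hT : T ⊆ S' ∪ T') :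
    S.card + T.card ≤ S'.card + T'.card := by
  rw [← Finset.card_union_of_disjoint hd]
  exact (Finset.card_le_card (Finset.union_subset hS hT)).trans (Finset.card_union_le _ _)

theorem mainTheorem9 {V E A : Type*} [Finite V] [Finite E] [Finite A]
    (G : MixedGraph V E A) (k : ℕ)
    (h : ∃ F : Fin k → Finset (E ⊕ A),
      (∀ i, G.IsMixedCoveringForest (F i)) ∧ ∀ i j, i ≠ j → Disjoint (F i) (F j)) :
    ∃ F : Fin k → Finset (E ⊕ A),
      (∀ i, G.IsMixedCoveringForest (F i)) ∧ (∀ i j, i ≠ j → Disjoint (F i) (F j)) ∧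
      ∀ i j,
        |((F i).card : ℤ) - ((F j).card : ℤ)| ≤ 2 ∧
        |((F i).toLeft.card : ℤ) - ((F j).toLeft.card : ℤ)| ≤ 1 ∧
        |((F i).toRight.card : ℤ) - ((F j).toRight.card : ℤ)| ≤ 2 := by
  -- A family of least total imbalance works: a pair violating the bounds could be rebalanced,
  -- lowering the total.
  classical
  obtain ⟨F, ⟨hF, hd⟩, hmin⟩ := Set.exists_min_image
    {F : Fin k → Finset (E ⊕ A) | (∀ i, G.IsMixedCoveringForest (F i)) ∧
      ∀ i j, i ≠ j → Disjoint (F i) (F j)} (fun F => ∑ i, imbalance (F i)) (Set.toFinite _) h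
  refine ⟨F, hF, hd, fun i j => ?_⟩
  by_contra hbad
  have hij : i ≠ j := by
    rintro rfl
    simp at hbad
  obtain ⟨P, hP, hPd, hPsub, h₁, h₂, h₃⟩ := MixedGraph.exists_balanced_pair
    (G := G) (fun b : Bool => if b then F i else F j) (fun b => by cases b <;> simp [hF])
    (by simpa using hd i j hij)
  have hsub : ∀ b, P b ⊆ F i ∪ F j := fun b x hx => by
    obtain ⟨c, hc⟩ := hPsub b x hx
    cases c
    · exact Finset.mem_union_right _ (by simpa using hc)
    · exact Finset.mem_union_left _ (by simpa using hc)
  let F' : Fin k → Finset (E ⊕ A) := Function.update (Function.update F i (P true)) j (P false)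
  have hi : F' i = P true := by simp [F', hij]
  have hj : F' j = P false := by simp [F']
  have hne : ∀ l, l ≠ i → l ≠ j → F' l = F l := fun l h h' => by simp [F', h, h']
  have hPF : ∀ b l, l ≠ i → l ≠ j → Disjoint (P b) (F l) := fun b l hl hl' =>
    (Finset.disjoint_union_left.2 ⟨hd _ _ hl.symm, hd _ _ hl'.symm⟩).mono_left (hsub b)
  have hlt : imbalance (P true) + imbalance (P false) < imbalance (F i) + imbalance (F j) := by
    simp only [imbalance]
    simp only [← Finset.card_toLeft_add_card_toRight] at h₁ hbad ⊢
    refine imbalance_lt (card_add_card_le_of_subset_union ?_ ?_ ?_)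
      (card_add_card_le_of_subset_union ?_ ?_ ?_) h₁ h₂ h₃ hbad
    · rw [Finset.disjoint_left]
      exact fun e h h' =>
        Finset.disjoint_left.1 hPd (Finset.mem_toLeft.1 h) (Finset.mem_toLeft.1 h')
    · exact fun e h => by simpa using hsub _ (Finset.mem_toLeft.1 h)
    · exact fun e h => by simpa using hsub _ (Finset.mem_toLeft.1 h)
    · rw [Finset.disjoint_left]
      exact fun e h h' =>
        Finset.disjoint_left.1 hPd (Finset.mem_toRight.1 h) (Finset.mem_toRight.1 h')
    · exact fun e h => by simpa using hsub _ (Finset.mem_toRight.1 h)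
    · exact fun e h => by simpa using hsub _ (Finset.mem_toRight.1 h)
  have hsum : ∀ H : Fin k → Finset (E ⊕ A), ∑ l, imbalance (H l) = imbalance (H i) +
      (imbalance (H j) + ∑ l ∈ (Finset.univ.erase i).erase j, imbalance (H l)) := fun H => by
    rw [Finset.add_sum_erase _ (fun l => imbalance (H l)) (by simp [hij.symm]),
      Finset.add_sum_erase _ (fun l => imbalance (H l)) (Finset.mem_univ i)]
  have hle := hmin F' ⟨fun l => ?_, fun l m hlm => ?_⟩
  · simp only [hsum, hi, hj] at hle
    have hrest : ∑ l ∈ (Finset.univ.erase i).erase j, imbalance (F' l) =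
        ∑ l ∈ (Finset.univ.erase i).erase j, imbalance (F l) :=
      Finset.sum_congr rfl fun l hl => by
        simp only [Finset.mem_erase, Finset.mem_univ, and_true] at hl
        rw [hne l hl.2 hl.1]
    omega
  · by_cases hli : l = i
    · rw [hli, hi]
      exact hP _
    · by_cases hlj : l = j
      · rw [hlj, hj]
        exact hP _
      · rw [hne l hli hlj]
        exact hF l
  · by_cases hli : l = i
    · subst hli
      rw [hi]
      by_cases hmj : m = j
      · rwa [hmj, hj]
      · rw [hne m hlm.symm hmj]
        exact hPF _ _ hlm.symm hmj
    · by_cases hlj : l = j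
      · subst hlj
        rw [hj]
        by_cases hmi : m = i
        · rw [hmi, hi]
          exact hPd.symm
        · rw [hne m hmi hlm.symm]
          exact hPF _ _ hmi hlm.symm
      · rw [hne l hli hlj]
        by_cases hmi : m = i
        · rw [hmi, hi]
          exact (hPF _ _ hli hlj).symm
        · by_cases hmj : m = j
          · rw [hmj, hj]
            exact (hPF _ _ hli hlj).symm
          · rw [hne m hmi hmj]
            exact hd _ _ hlm
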